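/- For each \(k\in\mathbb N\) let \(d^{(k)}=(d_1,\dots,d_{n})\), \(n=n_k\), be a sequence of nonnegative real numbers with \(\max_i d_i^2\le S:=\sum_i d_i\), and put \(S_2=\sum_i d_i^2\), \(d_{\max}=\max_i d_i\), \(p_{\max}=d_{\max}^2/S\). Let \(G_k\) be the Chung–Lu random graph on the nodes \(1,\dots,n\) with expected degrees \(d^{(k)}\): every undirected edge \(\{i,j\}\) (self-loops \(i=j\) included) is present independently with probability \(p_{ij}=d_id_j/S\). Let \(s=s_k\) and \(t=t_k\) be two distinct nodes and \(r=r_k\in\mathbb N\). Let \(SP_r(s,t)\) be the number of simple paths of length \(r\) from \(s\) to \(t\) in \(G_k\), that is, of sequences \((x_0,\dots,x_r)\) of distinct nodes with \(x_0=s\), \(x_r=t\) in which every \(\{x_i,x_{i+1}\}\) is an edge, and let \(NBP_r(s,t)\) be the number of nonbacktracking paths of length \(r\) from \(s\) to \(t\), that is, of such sequences in which, instead of distinctness, one only requires \(x_i\neq x_{i+2}\) for \(0\le i\le r-2\). Suppose that, as \(k\to\infty\), \[ \frac{d_{\max}S}{S_2\min(d_s,d_t)}=o(1),\qquad r\frac{S}{S_2}=o(1),\qquad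 r^2\frac{S}{S_2}\,p_{\max}=o(1),\qquad \frac{1}{E(SP_r(s,t))}=o(1) \] (the last condition meaning that \(E(SP_r(s,t))\to\infty\)). Then with high probability \[ \frac{NBP_r(s,t)}{SP_r(s,t)}=1+o(1), \] that is, there is a deterministic sequence \(\delta_k\to0\) such that the probability that \(SP_r(s,t)>0\) and \(\left|\frac{NBP_r(s,t)}{SP_r(s,t)}-1\right|\le\delta_k\) tends to \(1\) as \(k\to\infty\). -/

import Mathlib

open MeasureTheory ProbabilityTheory Filter Topology

/-- An expected degree sequence `d_1, …, d_n` admissible for the Chung–Lu model: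
the degrees are nonnegative and `max_i d_i ^ 2 ≤ S`, where `S = ∑ i, d_i`. -/
structure ExpectedDegrees (n : ℕ) where
  /-- the expected degree of each node -/
  d : Fin n → ℝ
  nonneg : ∀ i, 0 ≤ d i
  sq_le : ∀ i, d i ^ 2 ≤ ∑ j, d j

namespace ExpectedDegrees

variable {n : ℕ} (D : ExpectedDegrees n)

/-- `S = ∑ i, d_i`. -/
noncomputable def S : ℝ := ∑ i, D.d i

/-- `S₂ = ∑ i, d_i ^ 2`. -/
noncomputable def S₂ : ℝ := ∑ i, D.d i ^ 2

/-- `d_max = max_i d_i`. -/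
noncomputable def dmax : ℝ := ⨆ i, D.d i

/-- `p_max = d_max ^ 2 / S`. -/
noncomputable def pmax : ℝ := D.dmax ^ 2 / D.S

theorem mul_div_mem (i j : Fin n) : D.d i * D.d j / D.S ∈ unitInterval := by
  have hS : 0 ≤ D.S := Finset.sum_nonneg fun i _ => D.nonneg i
  refine ⟨div_nonneg (mul_nonneg (D.nonneg i) (D.nonneg j)) hS, div_le_one_of_le₀ ?_ hS⟩
  have hi : D.d i ^ 2 ≤ D.S := D.sq_le i
  have hj : D.d j ^ 2 ≤ D.S := D.sq_le j
  nlinarith [sq_nonneg (D.d i - D.d j)]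

/-- The probability `p_{ij} = d_i d_j / S` of the undirected edge `{i, j}`
(a self-loop if `i = j`). -/
noncomputable def edgeProb : Sym2 (Fin n) → unitInterval :=
  Sym2.lift ⟨fun i j => ⟨D.d i * D.d j / D.S, D.mul_div_mem i j⟩, fun i j =>
    Subtype.ext (by simp only [mul_comm])⟩

/-- The law of the Chung–Lu random graph: all the edges `e` (self-loops included) are present
independently, with probabilities `edgeProb e`. A graph is encoded by the indicator function
of its edge set. -/
noncomputable def law : Measure (Sym2 (Fin n) → Bool) :=
  Measure.pi fun e => bernoulliMeasure true false (D.edgeProb e)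

end ExpectedDegrees

section Paths

variable {n : ℕ}

/-- `x_0, …, x_r` is a path (walk) of length `r` from `s` to `t` in the graph `G`. -/
def IsPath (G : Sym2 (Fin n) → Bool) (r : ℕ) (s t : Fin n) (x : Fin (r + 1) → Fin n) : Prop :=
  x 0 = s ∧ x (Fin.last r) = t ∧ ∀ i : Fin r, G s(x i.castSucc, x i.succ) = true

/-- A vertex sequence is nonbacktracking if `x_i ≠ x_{i+2}` for all `i`. -/
def Nonbacktracking {r : ℕ} (x : Fin (r + 1) → Fin n) : Prop :=
  ∀ i j : Fin (r + 1), (j : ℕ) = i + 2 → x i ≠ x j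

open Classical in
/-- The number `SP_r(s,t)` of simple paths (all nodes distinct) of length `r` from `s` to `t`. -/
noncomputable def SP (G : Sym2 (Fin n) → Bool) (r : ℕ) (s t : Fin n) : ℕ :=
  (Finset.univ.filter fun x : Fin (r + 1) → Fin n =>
    IsPath G r s t x ∧ Function.Injective x).card

open Classical in
/-- The number `NBP_r(s,t)` of nonbacktracking paths of length `r` from `s` to `t`. -/
noncomputable def NBP (G : Sym2 (Fin n) → Bool) (r : ℕ) (s t : Fin n) : ℕ :=
  (Finset.univ.filter fun x : Fin (r + 1) → Fin n =>
    IsPath G r s t x ∧ Nonbacktracking x).card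

end Paths

/-!
The proof is the first and second moment method. Write `g = S₂ / S`. The expected number of walks
of length `r` from `s` to `t`, if each of their steps is paid for separately, is
`μ = d_s d_t g ^ (r - 1) / S`. It is shown that `E(SP) ≥ (1 - o(1)) μ` (`le_integral_SP`), that
`E(NBP) ≤ (1 + o(1)) μ` (`integral_NBP_le`) and that `E(SP²) ≤ E(SP) (1 + (1 + o(1)) μ)`
(`integral_SP_sq_le`). Since `SP ≤ NBP`, Markov's inequality makes `NBP - SP` negligible compared
with `E(SP)`, and Chebyshev's inequality concentrates `SP` around `E(SP)` (`one_sub_le_law`).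

Path counts are computed recursively (`nbCount`, `spCount`). As the edges are independent,
conditioning on the presence of a set `E` of edges replaces the probabilities of the edges in `E`
by `1`, and the expected counts of continuations satisfy recursions that are estimated by
induction on the number of remaining steps.

* For the lower bound on `E(SP)`, the sum over the new nodes `w` of `d_w ^ 2 / S` is at least
  `g - (r + 1) p_max`.
* For nonbacktracking paths the difficulty lies in repeated edges, which cost nothing. A path can
  only start to repeat edges after it has returned to a visited node (possibly by a self-loop),
  which costs a factor of order `r p_max / g`. Then it has at most `r + 1` choices per repeated
  edge, whereas the mean growth is `g`, and `r / g → 0`. If the last step to `t` is a repeated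
  edge, then `t` has been visited before, which is a further coincidence. `NBBound` is the
  corresponding induction hypothesis.
* For the second moment, one simple path `x` is fixed and its edges are added to the graph. The
  expected number of simple paths is then at most the number of walks for the sum of the matrix
  `d_v d_w / S` and the adjacency matrix of `x` (`plantedWalks`). The latter has row sums at most
  `2`, and `d + δ 1_x` is superharmonic for the sum, up to a factor `1 + o(1)`, where
  `δ = 4 d_max / g` is negligible compared with `d_s` and `d_t`. The walks which stay on `x`
  contribute `1`, which is negligible as `E(SP) → ∞`.
-/

/-! ### Probabilities of sets of edges -/

namespace ExpectedDegrees

variable {n : ℕ} (D : ExpectedDegrees n)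

instance : IsProbabilityMeasure D.law := by
  unfold law; infer_instance

theorem integrable_law (f : (Sym2 (Fin n) → Bool) → ℝ) : Integrable f D.law :=
  Integrable.of_finite

/-- The product `p_{e₁} ⋯ p_{eₘ}` of the probabilities of the edges in `E`. -/
noncomputable def prodProb (E : Finset (Sym2 (Fin n))) : ℝ := ∏ e ∈ E, (D.edgeProb e : ℝ)

end ExpectedDegrees

/-- The indicator, as a real number, of the event that all the edges in `E` are in the graph. -/
noncomputable def present {n : ℕ} (E : Finset (Sym2 (Fin n))) (G : Sym2 (Fin n) → Bool) : ℝ :=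
  ∏ e ∈ E, if G e then 1 else 0

theorem present_insert_eq {n : ℕ} (E : Finset (Sym2 (Fin n))) (e : Sym2 (Fin n))
    (G : Sym2 (Fin n) → Bool) :
    present (insert e E) G = present E G * if G e then 1 else 0 := by
  classical
  unfold present
  by_cases he : e ∈ E
  · rw [Finset.insert_eq_of_mem he]
    by_cases hG : G e
    · simp [hG]
    · rw [Finset.prod_eq_zero he (by simp [hG]), zero_mul]
  · rw [Finset.prod_insert he, mul_comm]

theorem present_eq_ite {n : ℕ} (E : Finset (Sym2 (Fin n))) (G : Sym2 (Fin n) → Bool)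
    [Decidable (∀ e ∈ E, G e = true)] :
    present E G = if ∀ e ∈ E, G e = true then 1 else 0 := by
  unfold present
  split_ifs with h
  · exact Finset.prod_eq_one fun e he => by simp [h e he]
  · push Not at h
    obtain ⟨e, he, h⟩ := h
    exact Finset.prod_eq_zero he (by simp [h])

theorem present_nonneg {n : ℕ} (E : Finset (Sym2 (Fin n))) (G : Sym2 (Fin n) → Bool) :
    0 ≤ present E G :=
  Finset.prod_nonneg fun _ _ => by split_ifs <;> norm_num

namespace ExpectedDegrees

variable {n : ℕ} (D : ExpectedDegrees n)

theorem edgeProb_mk (u v : Fin n) : (D.edgeProb s(u, v) : ℝ) = D.d u * D.d v / D.S := rfl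

theorem integral_present (E : Finset (Sym2 (Fin n))) :
    ∫ G, present E G ∂D.law = D.prodProb E := by
  classical
  have h1 : ∀ G : Sym2 (Fin n) → Bool, present E G =
      ∏ e, (fun (e : Sym2 (Fin n)) (b : Bool) =>
        if e ∈ E then (if b then (1 : ℝ) else 0) else 1) e (G e) := by
    intro G
    simp [present, Finset.prod_ite_mem]
  have h2 := integral_fintype_prod_eq_prod (fun (e : Sym2 (Fin n)) (b : Bool) =>
      if e ∈ E then (if b then (1 : ℝ) else 0) else 1)
    (μ := fun e => bernoulliMeasure true false (D.edgeProb e))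
  rw [integral_congr_ae (ae_of_all _ h1), law, h2]
  unfold prodProb
  rw [← Finset.prod_filter_mul_prod_filter_not Finset.univ (· ∈ E)]
  rw [Finset.prod_eq_one (s := Finset.univ.filter (¬ · ∈ E)), mul_one]
  · rw [Finset.filter_univ_mem]
    refine Finset.prod_congr rfl fun e he => ?_
    simp [he, integral_bernoulliMeasure]
  · intro e he
    simp only [Finset.mem_filter, Finset.mem_univ, true_and] at he
    simp [he]

theorem prodProb_nonneg (E : Finset (Sym2 (Fin n))) : 0 ≤ D.prodProb E :=
  Finset.prod_nonneg fun e _ => (D.edgeProb e).2.1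

theorem prodProb_insert_of_mem {E : Finset (Sym2 (Fin n))} {e : Sym2 (Fin n)} (he : e ∈ E) :
    D.prodProb (insert e E) = D.prodProb E := by
  rw [Finset.insert_eq_of_mem he]

theorem prodProb_insert_of_notMem {E : Finset (Sym2 (Fin n))} {u v : Fin n}
    (he : s(u, v) ∉ E) :
    D.prodProb (insert s(u, v) E) = D.prodProb E * (D.d u * D.d v / D.S) := by
  rw [prodProb, Finset.prod_insert he, edgeProb_mk, mul_comm, prodProb]

theorem prodProb_insert_le (E : Finset (Sym2 (Fin n))) (e : Sym2 (Fin n)) :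
    D.prodProb (insert e E) ≤ D.prodProb E := by
  by_cases he : e ∈ E
  · rw [D.prodProb_insert_of_mem he]
  · rw [prodProb, Finset.prod_insert he]
    exact mul_le_of_le_one_left (D.prodProb_nonneg E) (D.edgeProb e).2.2

end ExpectedDegrees

/-! ### Recursive path counts -/

section Counts

variable {n : ℕ}

open Classical in
/-- The number of continuations, by `k` further steps ending at `t`, of a nonbacktracking path
that is at the node `v` and was at `u` one step before (`u = none` if `v` is its first node). -/
noncomputable def nbCount (G : Sym2 (Fin n) → Bool) (t : Fin n) :
    ℕ → Option (Fin n) → Fin n → ℝ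
  | 0, _, v => if v = t then 1 else 0
  | k + 1, u, v => ∑ w, if u = some w then 0 else
      (if G s(v, w) then 1 else 0) * nbCount G t k (some v) w

open Classical in
/-- The number of continuations, by `k` further steps ending at `t`, of a simple path that is at
the node `v` and has visited the set `A` of nodes. -/
noncomputable def spCount (G : Sym2 (Fin n) → Bool) (t : Fin n) :
    ℕ → Finset (Fin n) → Fin n → ℝ
  | 0, _, v => if v = t then 1 else 0
  | k + 1, A, v => ∑ w, if w ∈ A then 0 else
      (if G s(v, w) then 1 else 0) * spCount G t k (insert w A) w

theorem isPath_cons {G : Sym2 (Fin n) → Bool} {k : ℕ} {v t a : Fin n}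
    {y : Fin (k + 1) → Fin n} :
    IsPath G (k + 1) v t (Fin.cons a y : Fin (k + 2) → Fin n) ↔
      a = v ∧ G s(a, y 0) = true ∧ IsPath G k (y 0) t y := by
  unfold IsPath
  rw [Fin.forall_fin_succ]
  simp only [Fin.cons_zero, ← Fin.succ_last, Fin.cons_succ, Fin.castSucc_zero,
    ← Fin.succ_castSucc]
  tauto

theorem sum_cons {k : ℕ} (f : (Fin (k + 1) → Fin n) → ℝ) :
    ∑ x, f x = ∑ a : Fin n, ∑ y : Fin k → Fin n, f (Fin.cons a y) := by
  rw [← Fintype.sum_prod_type']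
  exact (Fintype.sum_equiv (Fin.consEquiv fun _ => Fin n) _ _ fun _ => rfl).symm

theorem nonbacktracking_cons {k : ℕ} {a : Fin n} {y : Fin (k + 1) → Fin n} :
    Nonbacktracking (Fin.cons a y : Fin (k + 2) → Fin n) ↔
      Nonbacktracking y ∧ ∀ j : Fin (k + 1), (j : ℕ) = 1 → a ≠ y j := by
  unfold Nonbacktracking
  rw [Fin.forall_fin_succ]
  conv_lhs => enter [1]; rw [Fin.forall_fin_succ]
  conv_lhs => enter [2, i]; rw [Fin.forall_fin_succ]
  simp only [Fin.cons_zero, Fin.cons_succ, Fin.val_succ, Fin.val_zero]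
  constructor
  · rintro ⟨⟨-, h1⟩, h2⟩
    exact ⟨fun i j hij => (h2 i).2 j (by omega), fun j hj => h1 j (by omega)⟩
  · rintro ⟨h1, h2⟩
    exact ⟨⟨fun h => by omega, fun j hj => h2 j (by omega)⟩,
      fun i => ⟨fun h => by omega, fun j hj => h1 i j (by omega)⟩⟩

theorem ite_zero_sum {ι : Type*} (A : Finset ι) (c : Prop) [Decidable c] (f : ι → ℝ) :
    (if c then 0 else ∑ i ∈ A, f i) = ∑ i ∈ A, if c then 0 else f i := by
  split_ifs <;> simp

open Classical in
theorem nbCount_eq_sum (G : Sym2 (Fin n) → Bool) (t : Fin n) (k : ℕ) :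
    ∀ (u : Option (Fin n)) (v : Fin n), nbCount G t k u v =
      ∑ x : Fin (k + 1) → Fin n, if IsPath G k v t x ∧ Nonbacktracking x ∧
        (∀ j : Fin (k + 1), (j : ℕ) = 1 → u ≠ some (x j)) then (1 : ℝ) else 0 := by
  induction k with
  | zero =>
    intro u v
    rw [Finset.sum_eq_single fun _ => v]
    · simp [nbCount, IsPath, Nonbacktracking]
    · intro x _ hx
      refine if_neg fun h => hx ?_
      funext i
      rw [Fin.fin_one_eq_zero i]
      exact h.1.1
    · simp
  | succ k ih =>
    intro u v
    rw [sum_cons, Finset.sum_eq_single v _ (by simp)]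
    · simp only [nbCount, ih]
      simp_rw [Finset.mul_sum, ite_zero_sum]
      rw [Finset.sum_comm]
      refine Finset.sum_congr rfl fun y _ => ?_
      rw [Finset.sum_eq_single (y 0) _ (by simp)]
      · have hone : (∀ j : Fin (k + 2), (j : ℕ) = 1 →
            u ≠ some ((Fin.cons v y : Fin (k + 2) → Fin n) j)) ↔ u ≠ some (y 0) := by
          rw [Fin.forall_fin_succ]
          simp only [Fin.cons_succ, Fin.val_succ, Fin.val_zero]
          refine ⟨fun h => h.2 0 (by simp), fun h => ⟨fun h => by omega, fun j hj => ?_⟩⟩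
          rwa [show j = 0 from Fin.ext (by simpa using hj)]
        simp only [isPath_cons, nonbacktracking_cons, hone, true_and, ne_eq, Option.some.injEq]
        by_cases h1 : u = some (y 0) <;> by_cases h2 : G s(v, y 0) = true <;>
          simp [h1, h2]
      · intro w _ hw
        have : ¬ IsPath G k w t y := fun h => hw h.1.symm
        simp [this]
    · intro a _ ha
      refine Finset.sum_eq_zero fun y _ => if_neg ?_
      rw [isPath_cons]
      tauto

theorem natCast_NBP (G : Sym2 (Fin n) → Bool) (r : ℕ) (s t : Fin n) :
    (NBP G r s t : ℝ) = nbCount G t r none s := by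
  classical
  rw [nbCount_eq_sum, NBP, Finset.card_filter]
  push_cast
  exact Finset.sum_congr rfl fun x _ => by congr 1; simp

open Classical in
theorem spCount_eq_sum (G : Sym2 (Fin n) → Bool) (t : Fin n) (k : ℕ) :
    ∀ (A : Finset (Fin n)) (v : Fin n), v ∈ A → spCount G t k A v =
      ∑ x : Fin (k + 1) → Fin n, if IsPath G k v t x ∧ Function.Injective x ∧
        (∀ j : Fin k, x j.succ ∉ A) then (1 : ℝ) else 0 := by
  induction k with
  | zero =>
    intro A v _
    rw [Finset.sum_eq_single fun _ => v]
    · simp [spCount, IsPath, Function.injective_of_subsingleton]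
    · intro x _ hx
      refine if_neg fun h => hx ?_
      funext i
      rw [Fin.fin_one_eq_zero i]
      exact h.1.1
    · simp
  | succ k ih =>
    intro A v hv
    rw [sum_cons, Finset.sum_eq_single v _ (by simp)]
    · simp only [spCount, ih _ _ (Finset.mem_insert_self _ _)]
      simp_rw [Finset.mul_sum, ite_zero_sum]
      rw [Finset.sum_comm]
      refine Finset.sum_congr rfl fun y _ => ?_
      rw [Finset.sum_eq_single (y 0) _ (by simp)]
      · have hinj : Function.Injective (Fin.cons v y : Fin (k + 2) → Fin n) ∧
            (∀ j : Fin (k + 1), y j ∉ A) ↔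
            Function.Injective y ∧ y 0 ∉ A ∧ ∀ j : Fin k, y j.succ ∉ insert (y 0) A := by
          rw [Fin.cons_injective_iff, Fin.forall_fin_succ]
          simp only [Finset.mem_insert, not_or, Set.mem_range, not_exists]
          constructor
          · rintro ⟨⟨-, h1⟩, h2, h3⟩
            exact ⟨h1, h2, fun j => ⟨fun h => Fin.succ_ne_zero j (h1 h), h3 j⟩⟩
          · rintro ⟨h1, h2, h3⟩
            refine ⟨⟨fun j => ?_, h1⟩, h2, fun j => (h3 j).2⟩
            refine Fin.cases (fun h => h2 (h ▸ hv)) (fun j h => (h3 j).2 (h ▸ hv)) j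
        simp only [isPath_cons, Fin.cons_succ, hinj, true_and]
        by_cases h1 : y 0 ∈ A <;> by_cases h2 : G s(v, y 0) = true <;>
          simp [h1, h2]
      · intro w _ hw
        have : ¬ IsPath G k w t y := fun h => hw h.1.symm
        simp [this]
    · intro a _ ha
      refine Finset.sum_eq_zero fun y _ => if_neg ?_
      rw [isPath_cons]
      tauto

theorem natCast_SP (G : Sym2 (Fin n) → Bool) (r : ℕ) (s t : Fin n) :
    (SP G r s t : ℝ) = spCount G t r {s} s := by
  classical
  rw [spCount_eq_sum G t r _ _ (Finset.mem_singleton_self s), SP, Finset.card_filter]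
  push_cast
  refine Finset.sum_congr rfl fun x _ => ?_
  congr 1
  refine propext (and_congr_right fun h => ⟨fun hx => ⟨hx, fun j => ?_⟩, fun hx => hx.1⟩)
  rw [Finset.mem_singleton, ← h.1]
  exact fun h => Fin.succ_ne_zero j (hx h)

/-- The edges traversed by a vertex sequence. -/
noncomputable def pathEdges {r : ℕ} (x : Fin (r + 1) → Fin n) : Finset (Sym2 (Fin n)) :=
  Finset.univ.image fun i : Fin r => s(x i.castSucc, x i.succ)

open Classical in
/-- The simple vertex sequences of length `r` from `s` to `t` in the complete graph. -/
noncomputable def simpleSeqs (r : ℕ) (s t : Fin n) : Finset (Fin (r + 1) → Fin n) :=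
  Finset.univ.filter fun x => x 0 = s ∧ x (Fin.last r) = t ∧ Function.Injective x

theorem natCast_SP_eq_sum_present (G : Sym2 (Fin n) → Bool) (r : ℕ) (s t : Fin n) :
    (SP G r s t : ℝ) = ∑ x ∈ simpleSeqs r s t, present (pathEdges x) G := by
  classical
  rw [SP, simpleSeqs, Finset.card_filter, Finset.sum_filter]
  push_cast
  refine Finset.sum_congr rfl fun x _ => ?_
  rw [present_eq_ite, ← ite_and]
  congr 1
  simp only [IsPath, pathEdges, Finset.mem_image, Finset.mem_univ, true_and,
    forall_exists_index, forall_apply_eq_imp_iff]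
  exact propext (by tauto)

theorem SP_le_NBP (G : Sym2 (Fin n) → Bool) (r : ℕ) (s t : Fin n) :
    SP G r s t ≤ NBP G r s t := by
  classical
  refine Finset.card_le_card fun x hx => ?_
  rw [Finset.mem_filter] at hx ⊢
  refine ⟨hx.1, hx.2.1, fun i j hij h => ?_⟩
  rw [hx.2.2 h] at hij
  omega

end Counts

/-! ### First moments -/

namespace ExpectedDegrees

variable {n : ℕ} (D : ExpectedDegrees n)

theorem d_le_dmax (i : Fin n) : D.d i ≤ D.dmax :=
  le_ciSup (f := D.d) (Set.finite_range _).bddAbove i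

theorem dmax_nonneg : 0 ≤ D.dmax := Real.iSup_nonneg D.nonneg

theorem S_nonneg : 0 ≤ D.S := Finset.sum_nonneg fun i _ => D.nonneg i

theorem S₂_nonneg : 0 ≤ D.S₂ := Finset.sum_nonneg fun i _ => sq_nonneg (D.d i)

theorem pmax_nonneg : 0 ≤ D.pmax := div_nonneg (sq_nonneg _) D.S_nonneg

theorem sq_div_le_pmax (i : Fin n) : D.d i ^ 2 / D.S ≤ D.pmax :=
  div_le_div_of_nonneg_right (pow_le_pow_left₀ (D.nonneg i) (D.d_le_dmax i) 2) D.S_nonneg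

/-- The growth rate `S₂ / S` of the expected number of walks. -/
noncomputable def growth : ℝ := D.S₂ / D.S

theorem growth_nonneg : 0 ≤ D.growth := div_nonneg D.S₂_nonneg D.S_nonneg

theorem sum_sq_div : ∑ w, D.d w ^ 2 / D.S = D.growth := by
  rw [← Finset.sum_div]; rfl

/-- One step of the recursion for the expected number of nonbacktracking continuations, given that
the edges in `E` are present. -/
theorem integral_present_mul_nbCount_succ (E : Finset (Sym2 (Fin n))) (t : Fin n) (k : ℕ)
    (u : Option (Fin n)) (v : Fin n) :
    ∫ G, present E G * nbCount G t (k + 1) u v ∂D.law =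
      ∑ w, if u = some w then 0 else
        ∫ G, present (insert s(v, w) E) G * nbCount G t k (some v) w ∂D.law := by
  simp only [nbCount, Finset.mul_sum]
  rw [integral_finsetSum _ fun w _ => D.integrable_law _]
  refine Finset.sum_congr rfl fun w _ => ?_
  split_ifs with h
  · simp
  · simp only [present_insert_eq, mul_assoc]

theorem integral_present_mul_spCount_succ (E : Finset (Sym2 (Fin n))) (t : Fin n) (k : ℕ)
    (A : Finset (Fin n)) (v : Fin n) :
    ∫ G, present E G * spCount G t (k + 1) A v ∂D.law =
      ∑ w, if w ∈ A then 0 else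
        ∫ G, present (insert s(v, w) E) G * spCount G t k (insert w A) w ∂D.law := by
  simp only [spCount, Finset.mul_sum]
  rw [integral_finsetSum _ fun w _ => D.integrable_law _]
  refine Finset.sum_congr rfl fun w _ => ?_
  split_ifs with h
  · simp
  · simp only [present_insert_eq, mul_assoc]

theorem integral_present_mul_const (E : Finset (Sym2 (Fin n))) (c : ℝ) :
    ∫ G, present E G * c ∂D.law = D.prodProb E * c := by
  rw [integral_mul_const, integral_present]

end ExpectedDegrees

theorem spCount_nonneg {n : ℕ} (G : Sym2 (Fin n) → Bool) (t : Fin n) (k : ℕ) :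
    ∀ A v, 0 ≤ spCount G t k A v := by
  induction k with
  | zero => intro u v; simp only [spCount]; split_ifs <;> norm_num
  | succ k ih =>
    intro u v
    refine Finset.sum_nonneg fun w _ => ?_
    split_ifs
    · exact le_rfl
    · simpa using ih _ _
    · simp

namespace ExpectedDegrees

variable {n : ℕ} (D : ExpectedDegrees n)

theorem mem_insert_of_edge {n : ℕ} {E : Finset (Sym2 (Fin n))} {A : Finset (Fin n)} {v : Fin n}
    (hv : v ∈ A) (hE : ∀ a b, s(a, b) ∈ E → b ∈ A) (w a b : Fin n)
    (h : s(a, b) ∈ insert s(v, w) E) : b ∈ insert w A := by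
  rw [Finset.mem_insert, Sym2.eq_iff] at h
  rw [Finset.mem_insert]
  rcases h with (⟨-, rfl⟩ | ⟨-, rfl⟩) | h
  · exact .inl rfl
  · exact .inr hv
  · exact .inr (hE _ _ h)

/-- The set `A` of visited nodes contains all the endpoints of the edges in `E`, so that each step to
a new node uses a new edge. -/
theorem le_integral_present_mul_spCount (t : Fin n) (N : ℕ) {L : ℝ} (hL : 0 ≤ L)
    (hLN : L ≤ D.growth - N * D.pmax) (k : ℕ) :
    ∀ (E : Finset (Sym2 (Fin n))) (A : Finset (Fin n)) (v : Fin n), v ∈ A → t ∉ A →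
      (∀ a b, s(a, b) ∈ E → b ∈ A) → A.card + k + 1 ≤ N →
      D.prodProb E * (D.d v * D.d t / D.S * L ^ k) ≤
        ∫ G, present E G * spCount G t (k + 1) A v ∂D.law := by
  induction k with
  | zero =>
    intro E A v hv ht hE _
    rw [integral_present_mul_spCount_succ]
    have hnew : s(v, t) ∉ E := fun h => ht (hE _ _ h)
    refine le_trans (le_of_eq ?_) (Finset.single_le_sum (fun w _ => ?_) (Finset.mem_univ t))
    · simp only [if_neg ht, spCount, if_true]
      rw [integral_present_mul_const, D.prodProb_insert_of_notMem hnew]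
      ring
    · split_ifs
      · exact le_rfl
      · exact integral_nonneg fun G => mul_nonneg (present_nonneg _ _) (spCount_nonneg _ _ _ _ _)
  | succ k ih =>
    intro E A v hv ht hE hcard
    rw [integral_present_mul_spCount_succ]
    have hc : (insert t A).card ≤ N := (Finset.card_insert_le _ _).trans (by omega)
    have hS : L ≤ ∑ w ∈ (insert t A)ᶜ, D.d w ^ 2 / D.S := by
      have h1 := Finset.sum_add_sum_compl (insert t A) fun w => D.d w ^ 2 / D.S
      rw [D.sum_sq_div] at h1
      have h2 : ∑ w ∈ insert t A, D.d w ^ 2 / D.S ≤ N * D.pmax := by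
        refine (Finset.sum_le_card_nsmul _ _ _ fun w _ => D.sq_div_le_pmax w).trans ?_
        rw [nsmul_eq_mul]
        exact mul_le_mul_of_nonneg_right (by exact_mod_cast hc) D.pmax_nonneg
      linarith
    have hpos : 0 ≤ D.prodProb E * (D.d v * D.d t / D.S * L ^ k) :=
      mul_nonneg (D.prodProb_nonneg _) (mul_nonneg (D.mul_div_mem v t).1 (pow_nonneg hL _))
    calc D.prodProb E * (D.d v * D.d t / D.S * L ^ (k + 1))
        = D.prodProb E * (D.d v * D.d t / D.S * L ^ k) * L := by ring
      _ ≤ D.prodProb E * (D.d v * D.d t / D.S * L ^ k) *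
          ∑ w ∈ (insert t A)ᶜ, D.d w ^ 2 / D.S := mul_le_mul_of_nonneg_left hS hpos
      _ = ∑ w ∈ (insert t A)ᶜ, D.prodProb E * (D.d v * D.d w / D.S) *
          (D.d w * D.d t / D.S * L ^ k) := by
        rw [Finset.mul_sum]
        exact Finset.sum_congr rfl fun w _ => by ring
      _ ≤ ∑ w ∈ (insert t A)ᶜ, if w ∈ A then 0 else
        ∫ G, present (insert s(v, w) E) G * spCount G t (k + 1) (insert w A) w ∂D.law := by
        refine Finset.sum_le_sum fun w hw => ?_
        simp only [Finset.mem_compl, Finset.mem_insert, not_or] at hw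
        rw [if_neg hw.2, ← D.prodProb_insert_of_notMem fun h => hw.2 (hE _ _ h)]
        refine ih _ _ _ (Finset.mem_insert_self _ _) ?_ (mem_insert_of_edge hv hE w) ?_
        · rw [Finset.mem_insert, not_or]
          exact ⟨fun h => hw.1 h.symm, ht⟩
        · have := Finset.card_insert_le w A
          omega
      _ ≤ _ := by
        refine Finset.sum_le_univ_sum_of_nonneg fun w => ?_
        split_ifs
        · exact le_rfl
        · exact integral_nonneg fun G =>
            mul_nonneg (present_nonneg _ _) (spCount_nonneg _ _ _ _ _)

/-- Lower bound for the expected number of simple paths. A path has `m + 2` nodes. -/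
theorem le_integral_SP {s t : Fin n} (hst : s ≠ t) (m : ℕ) {L : ℝ} (hL : 0 ≤ L)
    (hLN : L ≤ D.growth - (m + 2 : ℕ) * D.pmax) :
    D.d s * D.d t / D.S * L ^ m ≤ ∫ G, (SP G (m + 1) s t : ℝ) ∂D.law := by
  have h := D.le_integral_present_mul_spCount t (m + 2) hL hLN m ∅ {s} s
    (Finset.mem_singleton_self s) (by simpa using hst.symm) (by simp) (by simp; omega)
  simpa [prodProb, present, natCast_SP] using h

/-- Upper bounds, uniform in the past of the path, for the expected number of ways to continue a
nonbacktracking path by `k` steps to the node `t`. The past is recorded by the set `E` of its edges,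
the set `A` of its nodes, its last node `v` and its last but one node `u`.
The first bound holds always, the second one (proportional to `d v`) holds if `v` has just been
visited for the first time, so that the only edge of `E` at `v` is the one which may not be
traversed back. The terms with `b` and `b'` appear only if `t` has already been visited,
so that the last step may reuse an edge. -/
def NBBound (t : Fin n) (N k : ℕ) (a a' b b' : ℝ) : Prop :=
  ∀ (E : Finset (Sym2 (Fin n))) (A : Finset (Fin n)) (u : Option (Fin n)) (v : Fin n), v ∈ A →
    (∀ x y, s(x, y) ∈ E → y ∈ A) → A.card + k ≤ N →
    ∫ G, present E G * nbCount G t k u v ∂D.law ≤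
        D.prodProb E * (a' + (if t ∈ A then 1 else 0) * b') ∧
    ((∀ w, s(v, w) ∈ E → u = some w) →
      ∫ G, present E G * nbCount G t k u v ∂D.law ≤
        D.prodProb E * (D.d v * (a + (if t ∈ A then 1 else 0) * b)))

/-- The last step: an edge to `t` that is already present costs nothing, but then `t ∈ A`. -/
theorem nbBound_one (t : Fin n) (N : ℕ) {a' b' : ℝ} (ha' : D.dmax * (D.d t / D.S) ≤ a')
    (hb' : 1 ≤ b') : D.NBBound t N 1 (D.d t / D.S) a' 0 b' := by
  intro E A u v hv hE _
  have hP := D.prodProb_nonneg E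
  have hdt : 0 ≤ D.d t / D.S := div_nonneg (D.nonneg t) D.S_nonneg
  have ha0 : 0 ≤ a' := (mul_nonneg D.dmax_nonneg hdt).trans ha'
  have hint : ∫ G, present E G * nbCount G t 1 u v ∂D.law =
      if u = some t then 0 else D.prodProb (insert s(v, t) E) := by
    rw [integral_present_mul_nbCount_succ, Finset.sum_eq_single t]
    · simp only [nbCount, if_true]
      rw [integral_present_mul_const, mul_one]
    · intro w _ hw
      simp [nbCount, hw]
    · simp
  have hnew : s(v, t) ∉ E → D.prodProb (insert s(v, t) E) =
      D.prodProb E * (D.d v * (D.d t / D.S)) := fun h => by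
    rw [D.prodProb_insert_of_notMem h]; ring
  rw [hint]
  constructor
  · by_cases hu : u = some t
    · rw [if_pos hu]
      exact mul_nonneg hP (by split_ifs <;> linarith)
    rw [if_neg hu]
    by_cases ht : t ∈ A
    · rw [if_pos ht, one_mul]
      refine (D.prodProb_insert_le _ _).trans ?_
      nlinarith
    · rw [if_neg ht, hnew fun h => ht (hE _ _ h)]
      refine mul_le_mul_of_nonneg_left ?_ hP
      have := mul_le_mul_of_nonneg_right (D.d_le_dmax v) hdt
      linarith
  · intro hfresh
    rw [mul_zero, add_zero]
    by_cases hu : u = some t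
    · rw [if_pos hu]
      exact mul_nonneg hP (mul_nonneg (D.nonneg v) hdt)
    · rw [if_neg hu, hnew fun h => hu (hfresh _ h)]

/-- The recursion between the bounds for `k` and for `k + 1` steps: the next node is either
reached for the first time, or it is one of the at most `N` nodes already visited, and in the
latter case a new edge has to be paid for if the present node has just been visited for the
first time. -/
theorem NBBound.succ {t : Fin n} {N k : ℕ} {a a' b b' a₁ a₁' b₁ b₁' : ℝ}
    (h : D.NBBound t N k a a' b b') (ha : 0 ≤ a) (ha' : 0 ≤ a') (hb : 0 ≤ b) (hb' : 0 ≤ b')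
    (h₁ : D.growth * a + D.d t ^ 2 / D.S * b + N * (D.dmax / D.S * a') ≤ a₁)
    (h₂ : D.growth * b + N * (D.dmax / D.S * b') ≤ b₁)
    (h₃ : D.dmax * (D.growth * a + D.d t ^ 2 / D.S * b) + N * a' ≤ a₁')
    (h₄ : D.dmax * (D.growth * b) + N * b' ≤ b₁') :
    D.NBBound t N (k + 1) a₁ a₁' b₁ b₁' := by
  intro E A u v hv hE hcard
  have hP := D.prodProb_nonneg E
  have hS := D.S_nonneg
  have hdv := D.nonneg v
  set τ : ℝ := if t ∈ A then 1 else 0 with hτ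
  have hτ0 : 0 ≤ τ := by rw [hτ]; split_ifs <;> norm_num
  set f : Fin n → ℝ := fun w => if u = some w then 0 else
        ∫ G, present (insert s(v, w) E) G * nbCount G t k (some v) w ∂D.law with hf
  have hIH : ∀ w, A.card + (k + 1) ≤ N → (insert w A).card + k ≤ N := fun w hw => by
    have := Finset.card_insert_le w A
    omega
  have hg : ∀ w, 0 ≤ D.prodProb E * (D.d v * D.d w / D.S *
      (D.d w * (a + (τ + if w = t then 1 else 0) * b))) := fun w => by
    have h1 : (0 : ℝ) ≤ if w = t then 1 else 0 := by split_ifs <;> norm_num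
    have h2 := D.nonneg w
    positivity
  -- the next node is a new one
  have hout : ∑ w ∈ Aᶜ, f w ≤ D.prodProb E * (D.d v *
      (D.growth * (a + τ * b) + D.d t ^ 2 / D.S * b)) := by
    calc ∑ w ∈ Aᶜ, f w ≤ ∑ w ∈ Aᶜ, D.prodProb E * (D.d v * D.d w / D.S *
          (D.d w * (a + (τ + if w = t then 1 else 0) * b))) := by
          refine Finset.sum_le_sum fun w hw => ?_
          rw [Finset.mem_compl] at hw
          simp only [hf]
          by_cases hu : u = some w
          · rw [if_pos hu]
            exact hg w
          rw [if_neg hu]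
          have hnew : s(v, w) ∉ E := fun h => hw (hE _ _ h)
          refine ((h _ _ (some v) w (Finset.mem_insert_self _ _) (mem_insert_of_edge hv hE w)
            (hIH w hcard)).2 fun z hz => ?_).trans ?_
          · rw [Finset.mem_insert, Sym2.eq_iff] at hz
            rcases hz with (⟨rfl, -⟩ | ⟨-, rfl⟩) | hz
            · exact absurd hv hw
            · rfl
            · exact absurd (hE z w (Sym2.eq_swap ▸ hz)) hw
          · rw [D.prodProb_insert_of_notMem hnew, mul_assoc]
            refine mul_le_mul_of_nonneg_left (mul_le_mul_of_nonneg_left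
              (mul_le_mul_of_nonneg_left ?_ (D.nonneg w)) (D.mul_div_mem v w).1) hP
            refine add_le_add_right (mul_le_mul_of_nonneg_right ?_ hb) a
            simp only [hτ, Finset.mem_insert, eq_comm (a := t)]
            by_cases h1 : w = t <;> by_cases h2 : t ∈ A <;> simp [h1, h2]
      _ ≤ ∑ w, D.prodProb E * (D.d v * D.d w / D.S *
          (D.d w * (a + (τ + if w = t then 1 else 0) * b))) :=
        Finset.sum_le_univ_sum_of_nonneg hg
      _ = ∑ w, (D.prodProb E * D.d v * (a + τ * b) * (D.d w ^ 2 / D.S) +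
          if w = t then D.prodProb E * D.d v * b * (D.d t ^ 2 / D.S) else 0) := by
        refine Finset.sum_congr rfl fun w _ => ?_
        split_ifs with hw
        · subst hw; ring
        · ring
      _ = _ := by
        rw [Finset.sum_add_distrib, ← Finset.mul_sum, D.sum_sq_div]
        simp only [Finset.sum_ite_eq', Finset.mem_univ, if_true]
        ring
  have hvis : ∀ w ∈ A, f w ≤ if u = some w then 0 else
      D.prodProb (insert s(v, w) E) * (a' + τ * b') := fun w hw => by
    simp only [hf]
    by_cases hu : u = some w
    · rw [if_pos hu, if_pos hu]
    · rw [if_neg hu, if_neg hu]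
      have := (h (insert s(v, w) E) A (some v) w hw (fun x y hxy => ?_) (by omega)).1
      · exact this
      · have := mem_insert_of_edge hv hE w x y hxy
        rwa [Finset.insert_eq_of_mem hw] at this
  constructor
  · rw [integral_present_mul_nbCount_succ, ← Finset.sum_add_sum_compl A]
    have hin : ∑ w ∈ A, f w ≤ N * (D.prodProb E * (a' + τ * b')) := by
      refine (Finset.sum_le_card_nsmul _ _ (D.prodProb E * (a' + τ * b')) fun w hw => ?_).trans ?_
      · refine (hvis w hw).trans ?_
        split_ifs
        · positivity
        · exact mul_le_mul_of_nonneg_right (D.prodProb_insert_le _ _) (by positivity)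
      · rw [nsmul_eq_mul]
        exact mul_le_mul_of_nonneg_right (by exact_mod_cast (by omega : A.card ≤ N))
          (by positivity)
    refine (add_le_add hin hout).trans ?_
    have h5 := mul_le_mul_of_nonneg_left h₄ hτ0
    have h6 := D.growth_nonneg
    have h7 : D.d v * (D.growth * (a + τ * b) + D.d t ^ 2 / D.S * b) ≤
        D.dmax * (D.growth * (a + τ * b) + D.d t ^ 2 / D.S * b) :=
      mul_le_mul_of_nonneg_right (D.d_le_dmax v) (by positivity)
    refine le_trans (le_of_eq ?_) (mul_le_mul_of_nonneg_left
      (by linarith : N * (a' + τ * b') + D.d v *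
        (D.growth * (a + τ * b) + D.d t ^ 2 / D.S * b) ≤ a₁' + τ * b₁') hP)
    ring
  · intro hfresh
    rw [integral_present_mul_nbCount_succ, ← Finset.sum_add_sum_compl A]
    have hin : ∑ w ∈ A, f w ≤ N * (D.prodProb E * (D.d v * (D.dmax / D.S) * (a' + τ * b'))) := by
      refine (Finset.sum_le_card_nsmul _ _
        (D.prodProb E * (D.d v * (D.dmax / D.S) * (a' + τ * b'))) fun w hw => ?_).trans ?_
      · have hdm := D.dmax_nonneg
        refine (hvis w hw).trans ?_
        split_ifs with hu
        · positivity
        · rw [D.prodProb_insert_of_notMem fun hm => hu (hfresh w hm), mul_div_assoc,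
            ← mul_assoc (D.prodProb E) (D.d v * (D.dmax / D.S))]
          have hab : 0 ≤ a' + τ * b' := by positivity
          refine mul_le_mul_of_nonneg_right (mul_le_mul_of_nonneg_left
            (mul_le_mul_of_nonneg_left ?_ hdv) hP) hab
          exact div_le_div_of_nonneg_right (D.d_le_dmax w) hS
      · rw [nsmul_eq_mul]
        have := D.dmax_nonneg
        exact mul_le_mul_of_nonneg_right (by exact_mod_cast (by omega : A.card ≤ N))
          (by positivity)
    refine (add_le_add hin hout).trans ?_
    have h5 := mul_le_mul_of_nonneg_left h₂ hτ0
    refine le_trans (le_of_eq ?_) (mul_le_mul_of_nonneg_left (mul_le_mul_of_nonneg_left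
      (by linarith : (D.growth * (a + τ * b) + D.d t ^ 2 / D.S * b) +
        N * (D.dmax / D.S * (a' + τ * b')) ≤ a₁ + τ * b₁) hdv) hP)
    ring

/-- Upper bound for the expected number of nonbacktracking paths. At the start `t` has not been
visited, so that the terms with the factor `β` do not appear. -/
theorem integral_NBP_le {s t : Fin n} (hst : s ≠ t) (m : ℕ) (hg : 0 < D.growth)
    (hN : 2 * (m + 2 : ℕ) ≤ D.growth) (hp : 2 * (m + 2 : ℕ) ^ 2 * D.pmax ≤ D.growth) {α : ℝ}
    (hα : α = 2 * (m + 2 : ℕ) ^ 2 * D.pmax / D.growth ^ 2 + 2 * (m + 2 : ℕ) * D.pmax / D.growth) :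
    ∫ G, (NBP G (m + 1) s t : ℝ) ∂D.law ≤
      D.d s * (D.d t / D.S * (D.growth * (1 + α)) ^ m) := by
  set N : ℕ := m + 2
  have hdm := D.dmax_nonneg
  have hpm := D.pmax_nonneg
  have hdt := D.nonneg t
  have hS : 0 < D.S := by
    refine lt_of_le_of_ne D.S_nonneg fun h => ?_
    simp [growth, ← h] at hg
  have hα0 : 0 ≤ α := by rw [hα]; positivity
  set g := D.growth
  -- `β` is chosen such that the bounds `k β g ^ k` and `2 g ^ k` fit together
  set β : ℝ := 2 * N * (D.dmax / D.S) / g with hβ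
  have hβ0 : 0 ≤ β := by positivity
  have hβg : β * g = 2 * N * (D.dmax / D.S) := by rw [hβ]; field_simp
  have hdβ : D.dmax * β * g = 2 * N * D.pmax := by
    rw [mul_assoc, hβg, pmax]; ring
  have hαg : g * α * g = 2 * N ^ 2 * D.pmax + 2 * N * D.pmax * g := by
    rw [hα]; field_simp
  have key : ∀ k : ℕ, k + 1 ≤ N → D.NBBound t N (k + 1) (D.d t / D.S * (g * (1 + α)) ^ k)
      (2 * D.dmax * (D.d t / D.S * (g * (1 + α)) ^ k)) (k * β * g ^ k) (2 * g ^ k) := by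
    intro k
    induction k with
    | zero =>
      intro _
      have := D.nbBound_one t N (a' := 2 * D.dmax * (D.d t / D.S)) (b' := 2)
        (by have : 0 ≤ D.dmax * (D.d t / D.S) := by positivity
            linarith) (by norm_num)
      simpa using this
    | succ k ih =>
      intro hk
      have hkN : (k : ℝ) ≤ N := by exact_mod_cast (by omega : k ≤ N)
      set a := D.d t / D.S * (g * (1 + α)) ^ k with ha
      have ha0 : 0 ≤ a := by positivity
      have ha1 : D.d t / D.S * (g * (1 + α)) ^ (k + 1) = g * (1 + α) * a := by rw [ha]; ring
      have hlow : D.d t / D.S * g ^ k ≤ a := by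
        refine mul_le_mul_of_nonneg_left (pow_le_pow_left₀ hg.le ?_ k) (by positivity)
        nlinarith
      have hkβ : D.d t * (k * β) * g ≤ 2 * N ^ 2 * D.pmax := by
        calc D.d t * (k * β) * g ≤ D.dmax * (N * β) * g := by
              gcongr
              exact D.d_le_dmax t
          _ = N * (D.dmax * β * g) := by ring
          _ = _ := by rw [hdβ]; ring
      have hq : D.d t ^ 2 / D.S * (k * β * g ^ k) + 2 * N * D.pmax * a ≤ g * α * a := by
        have h1 : (D.d t * (k * β) * g) * (D.d t / D.S * g ^ k) ≤ 2 * N ^ 2 * D.pmax * a :=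
          mul_le_mul hkβ hlow (by positivity) (by positivity)
        refine le_of_mul_le_mul_right (a := g) ?_ hg
        calc _ = (D.d t * (k * β) * g) * (D.d t / D.S * g ^ k) + 2 * N * D.pmax * g * a := by ring
          _ ≤ (g * α * g) * a := by rw [hαg]; linarith
          _ = _ := by ring
      have hpS : D.dmax / D.S * (2 * D.dmax * a) = 2 * D.pmax * a := by rw [pmax]; ring
      have hpa : 0 ≤ 2 * N * D.pmax * a := by positivity
      refine (ih (by omega)).succ D ha0 (by positivity) (by positivity) (by positivity) ?_ ?_ ?_ ?_
      · rw [ha1, hpS]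
        linarith
      · push_cast
        refine le_of_eq ?_
        calc _ = (k * β * g ^ (k + 1)) + (2 * N * (D.dmax / D.S)) * g ^ k := by ring
          _ = _ := by rw [← hβg]; ring
      · rw [ha1]
        have h2 : g * a + D.d t ^ 2 / D.S * (k * β * g ^ k) ≤ g * (1 + α) * a := by linarith
        have h3 := mul_le_mul_of_nonneg_left h2 hdm
        have h4 : 2 * N * (D.dmax * a) ≤ g * (1 + α) * (D.dmax * a) :=
          mul_le_mul_of_nonneg_right (by nlinarith) (by positivity)
        linarith
      · have h5 : D.dmax * β * g * k ≤ g := by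
          rw [hdβ]
          calc 2 * N * D.pmax * k ≤ 2 * N * D.pmax * N := by gcongr
            _ = 2 * N ^ 2 * D.pmax := by ring
            _ ≤ g := hp
        have h6 : 0 < g ^ k := by positivity
        calc _ = (D.dmax * β * g * k + 2 * N) * g ^ k := by ring
          _ ≤ (g + g) * g ^ k := by gcongr
          _ = _ := by ring
  have h := (key m (by omega) ∅ {s} none s (Finset.mem_singleton_self s) (by simp)
    (by simp [N]; omega)).2 (by simp)
  simpa [prodProb, present, natCast_NBP, hst.symm] using h

end ExpectedDegrees

/-! ### Walks along a fixed path -/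

section PathStep

variable {n r : ℕ} (x : Fin (r + 1) → Fin n)

/-- The adjacency operator of the path `x_0, …, x_r`: the value at `v` is the sum of the values
of `f` at the neighbours of `v` on the path. -/
noncomputable def pathStep (f : Fin n → ℝ) (v : Fin n) : ℝ :=
  ∑ j : Fin r, ((if v = x j.castSucc then f (x j.succ) else 0) +
    if v = x j.succ then f (x j.castSucc) else 0)

variable {x}

theorem pathStep_mono {f g : Fin n → ℝ} (h : ∀ v, f v ≤ g v) (v : Fin n) :
    pathStep x f v ≤ pathStep x g v := by
  refine Finset.sum_le_sum fun j _ => add_le_add ?_ ?_ <;> split_ifs <;> simp [h]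

theorem pathStep_nonneg {f : Fin n → ℝ} (h : ∀ v, 0 ≤ f v) (v : Fin n) : 0 ≤ pathStep x f v := by
  refine Finset.sum_nonneg fun j _ => add_nonneg ?_ ?_ <;> split_ifs <;> simp [h]

theorem pathStep_add_mul (f g : Fin n → ℝ) (c : ℝ) (v : Fin n) :
    pathStep x (fun w => f w + c * g w) v = pathStep x f v + c * pathStep x g v := by
  simp only [pathStep, Finset.mul_sum, ← Finset.sum_add_distrib]
  refine Finset.sum_congr rfl fun j _ => ?_
  split_ifs <;> ring

theorem sum_ite_eq_le_one {ι : Type*} [Fintype ι] {f : ι → Fin n} (hf : Function.Injective f)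
    (v : Fin n) : ∑ j, (if v = f j then (1 : ℝ) else 0) ≤ 1 := by
  classical
  by_cases h : ∃ j, v = f j
  · obtain ⟨j, rfl⟩ := h
    simp [hf.eq_iff]
  · push Not at h
    simp [h]

open Classical in
theorem pathStep_le (hx : Function.Injective x) {f : Fin n → ℝ} {B : ℝ} (hB : 0 ≤ B)
    (hf : ∀ v, f v ≤ B) (v : Fin n) :
    pathStep x f v ≤ 2 * B * if v ∈ Finset.univ.image x then 1 else 0 := by
  split_ifs with hv
  · have h1 := sum_ite_eq_le_one (hx.comp (Fin.castSucc_injective r)) v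
    have h2 := sum_ite_eq_le_one (hx.comp (Fin.succ_injective r)) v
    calc pathStep x f v ≤ ∑ j : Fin r, (B * (if v = (x ∘ Fin.castSucc) j then 1 else 0) +
          B * if v = (x ∘ Fin.succ) j then 1 else 0) := by
          refine Finset.sum_le_sum fun j _ => add_le_add ?_ ?_ <;>
            simp only [Function.comp_apply] <;> split_ifs <;> simp [hf]
      _ = B * (∑ j : Fin r, (if v = (x ∘ Fin.castSucc) j then 1 else 0)) +
          B * ∑ j : Fin r, if v = (x ∘ Fin.succ) j then 1 else 0 := by
          rw [Finset.sum_add_distrib, Finset.mul_sum, Finset.mul_sum]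
      _ ≤ B * 1 + B * 1 := by gcongr
      _ = _ := by ring
  · have h : ∀ i, v ≠ x i := fun i hi => hv (hi ▸ Finset.mem_image_of_mem x (Finset.mem_univ i))
    simp [pathStep, h]

theorem sum_pathStep_le (hx : Function.Injective x) {f : Fin n → ℝ} (hf : ∀ v, 0 ≤ f v) :
    ∑ v, pathStep x f v ≤ 2 * ∑ v, f v := by
  have key : ∀ e : Fin r → Fin (r + 1), Function.Injective e →
      ∑ j, f (x (e j)) ≤ ∑ v, f v := fun e he => by
    rw [← Finset.sum_image (f := f) (g := fun j => x (e j)) (s := Finset.univ)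
      fun a _ b _ h => he (hx h)]
    exact Finset.sum_le_univ_sum_of_nonneg hf
  have h1 := key _ (Fin.castSucc_injective r)
  have h2 := key _ (Fin.succ_injective r)
  simp only [pathStep]
  rw [Finset.sum_comm]
  simp only [Finset.sum_add_distrib, Finset.sum_ite_eq', Finset.mem_univ, if_true]
  linarith

open Classical in
theorem sum_ite_mem_pathEdges_le {f : Fin n → ℝ} (hf : ∀ v, 0 ≤ f v) (v : Fin n) :
    ∑ w, (if s(v, w) ∈ pathEdges x then f w else 0) ≤ pathStep x f v := by
  have h1 : pathStep x f v = ∑ w, ∑ j : Fin r,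
      ((if v = x j.castSucc ∧ w = x j.succ then f w else 0) +
        if v = x j.succ ∧ w = x j.castSucc then f w else 0) := by
    rw [Finset.sum_comm]
    refine Finset.sum_congr rfl fun j _ => ?_
    rw [Finset.sum_add_distrib]
    simp only [ite_and]
    congr 1 <;> split_ifs <;> simp
  rw [h1]
  have hnn : ∀ w (j : Fin r), 0 ≤ (if v = x j.castSucc ∧ w = x j.succ then f w else 0) +
        if v = x j.succ ∧ w = x j.castSucc then f w else 0 := fun w j => by
    refine add_nonneg ?_ ?_ <;> split_ifs <;> simp [hf]
  refine Finset.sum_le_sum fun w _ => ?_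
  split_ifs with h
  · simp only [pathEdges, Finset.mem_image, Finset.mem_univ, true_and, Sym2.eq_iff] at h
    obtain ⟨j, h⟩ := h
    refine le_trans ?_ (Finset.single_le_sum (fun j _ => hnn w j) (Finset.mem_univ j))
    rcases h with ⟨h, h'⟩ | ⟨h, h'⟩
    · rw [if_pos ⟨h.symm, h'.symm⟩, le_add_iff_nonneg_right]
      split_ifs <;> simp [hf]
    · rw [if_pos (c := v = x j.succ ∧ _) ⟨h'.symm, h.symm⟩, le_add_iff_nonneg_left]
      split_ifs <;> simp [hf]
  · exact Finset.sum_nonneg fun j _ => hnn w j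

/-- The number of walks of length `k` from `v` to `t` along the path `x`. -/
noncomputable def pathWalks (x : Fin (r + 1) → Fin n) (t : Fin n) : ℕ → Fin n → ℝ
  | 0 => fun v => if v = t then 1 else 0
  | k + 1 => pathStep x (pathWalks x t k)

theorem pathWalks_nonneg (t : Fin n) (k : ℕ) : ∀ v, 0 ≤ pathWalks x t k v := by
  induction k with
  | zero => intro v; simp only [pathWalks]; split_ifs <;> norm_num
  | succ k ih => exact pathStep_nonneg ih

theorem sum_pathWalks_le (hx : Function.Injective x) (t : Fin n) (k : ℕ) :
    ∑ v, pathWalks x t k v ≤ 2 ^ k := by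
  induction k with
  | zero => simp [pathWalks]
  | succ k ih =>
    have := sum_pathStep_le hx (pathWalks_nonneg (x := x) t k)
    simp only [pathWalks, pow_succ]
    linarith

/-- The end of a path of length `r` is not reached from its node `x_i` along the path in fewer
than `r - i` steps, and in one way only in exactly `r - i` steps. -/
theorem pathWalks_last (hx : Function.Injective x) (k : ℕ) : ∀ i : Fin (r + 1),
    ((i : ℕ) + k < r → pathWalks x (x (Fin.last r)) k (x i) = 0) ∧
    ((i : ℕ) + k = r → pathWalks x (x (Fin.last r)) k (x i) ≤ 1) := by
  induction k with
  | zero =>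
    refine fun i => ⟨fun h => if_neg fun h' => ?_, fun _ => ?_⟩
    · rw [hx h'] at h
      simp at h
    · simp only [pathWalks]; split_ifs <;> norm_num
  | succ k ih =>
    refine fun i => ⟨fun h => ?_, fun h => ?_⟩
    · rw [pathWalks, pathStep]
      refine Finset.sum_eq_zero fun j _ => ?_
      simp only [hx.eq_iff]
      have h1 : (if i = j.castSucc then pathWalks x (x (Fin.last r)) k (x j.succ) else 0) = 0 := by
        split_ifs with hij
        · subst hij
          exact (ih _).1 (by simp at h ⊢; omega)
        · rfl
      have h2 : (if i = j.succ then pathWalks x (x (Fin.last r)) k (x j.castSucc) else 0) = 0 := by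
        split_ifs with hij
        · subst hij
          exact (ih _).1 (by simp at h ⊢; omega)
        · rfl
      rw [h1, h2, add_zero]
    · rw [pathWalks, pathStep]
      refine le_trans (Finset.sum_le_sum (g := fun j : Fin r =>
        if x i = (x ∘ Fin.castSucc) j then (1 : ℝ) else 0) fun j _ => ?_)
        (sum_ite_eq_le_one (hx.comp (Fin.castSucc_injective r)) (x i))
      simp only [hx.eq_iff, Function.comp_apply]
      have h2 : (if i = j.succ then pathWalks x (x (Fin.last r)) k (x j.castSucc) else 0) = 0 := by
        split_ifs with hij
        · subst hij
          exact (ih _).1 (by simp at h ⊢; omega)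
        · rfl
      rw [h2, add_zero]
      split_ifs with hij
      · subst hij
        exact (ih _).2 (by simp at h ⊢; omega)
      · rfl

end PathStep

/-! ### Second moment -/

namespace ExpectedDegrees

variable {n : ℕ} (D : ExpectedDegrees n) {r : ℕ}

/-- The expected number of walks of length `k` from `v` to `t` if the edges of the path `x` are
added to the random graph and each edge is drawn anew in each step. -/
noncomputable def plantedWalks (x : Fin (r + 1) → Fin n) (t : Fin n) : ℕ → Fin n → ℝ
  | 0 => fun v => if v = t then 1 else 0
  | k + 1 => fun v => ∑ w, D.d v * D.d w / D.S * plantedWalks x t k w +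
      pathStep x (plantedWalks x t k) v

theorem plantedWalks_nonneg (x : Fin (r + 1) → Fin n) (t : Fin n) (k : ℕ) :
    ∀ v, 0 ≤ D.plantedWalks x t k v := by
  induction k with
  | zero => intro v; simp only [plantedWalks]; split_ifs <;> norm_num
  | succ k ih =>
    exact fun v => add_nonneg (Finset.sum_nonneg fun w _ =>
      mul_nonneg (D.mul_div_mem v w).1 (ih w)) (pathStep_nonneg ih v)

/-- Given the edges of `x`, a simple path extended to a new node uses either an edge of `x` or a new
edge, so that its expected number of continuations is at most `plantedWalks`. -/
theorem integral_present_mul_spCount_le (x : Fin (r + 1) → Fin n) (t : Fin n) (k : ℕ) :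
    ∀ (E : Finset (Sym2 (Fin n))) (A : Finset (Fin n)) (v : Fin n), v ∈ A →
      (∀ a b, s(a, b) ∈ E → s(a, b) ∈ pathEdges x ∨ b ∈ A) →
      ∫ G, present E G * spCount G t k A v ∂D.law ≤ D.prodProb E * D.plantedWalks x t k v := by
  classical
  induction k with
  | zero =>
    intro E A v _ _
    simp only [spCount, plantedWalks]
    rw [integral_present_mul_const]
  | succ k ih =>
    intro E A v hv hE
    have hP := D.prodProb_nonneg E
    have hg := D.plantedWalks_nonneg x t k
    rw [integral_present_mul_spCount_succ]
    calc _ ≤ ∑ w, (D.prodProb E * (D.d v * D.d w / D.S * D.plantedWalks x t k w) +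
          D.prodProb E * if s(v, w) ∈ pathEdges x then D.plantedWalks x t k w else 0) := by
          refine Finset.sum_le_sum fun w _ => ?_
          have hpw := mul_nonneg hP (mul_nonneg (D.mul_div_mem v w).1 (hg w))
          by_cases hw : w ∈ A
          · rw [if_pos hw]
            refine add_nonneg hpw (mul_nonneg hP ?_)
            split_ifs
            · exact hg w
            · exact le_rfl
          rw [if_neg hw]
          refine (ih _ _ w (Finset.mem_insert_self _ _) fun a b hab => ?_).trans ?_
          · rw [Finset.mem_insert, Sym2.eq_iff] at hab
            rw [Finset.mem_insert]
            rcases hab with (⟨-, rfl⟩ | ⟨-, rfl⟩) | hab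
            · exact .inr (.inl rfl)
            · exact .inr (.inr hv)
            · exact (hE _ _ hab).imp id .inr
          · by_cases hmem : s(v, w) ∈ E
            · rw [D.prodProb_insert_of_mem hmem, if_pos ((hE _ _ hmem).resolve_right hw)]
              linarith
            · rw [D.prodProb_insert_of_notMem hmem, mul_assoc]
              have : 0 ≤ D.prodProb E *
                  if s(v, w) ∈ pathEdges x then D.plantedWalks x t k w else 0 := by
                refine mul_nonneg hP ?_
                split_ifs
                · exact hg w
                · exact le_rfl
              linarith
      _ ≤ _ := by
          rw [Finset.sum_add_distrib, ← Finset.mul_sum, ← Finset.mul_sum, ← mul_add]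
          refine mul_le_mul_of_nonneg_left ?_ hP
          exact add_le_add_right (sum_ite_mem_pathEdges_le hg v) _

open Classical in
/-- The walks from `v` to `t` are split into those along `x` and those that make a step of the
random graph. The former contribute `pathWalks`. The latter end with some number `j ≤ m` of
steps along `x`, and the term `δ * (1 - 2⁻¹ ^ m)` accounts for all `j ≥ 1`, where at most `2 ^ j`
walks along `x` end at `t`. -/
theorem plantedWalks_le {x : Fin (r + 1) → Fin n} (hx : Function.Injective x) (t : Fin n)
    (hg : 4 ≤ D.growth) {δ η : ℝ} (hδ : δ = 4 * D.dmax / D.growth)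
    (hη : η = 4 * (r + 1 : ℕ) * D.pmax / D.growth ^ 2) (m : ℕ) : ∀ v : Fin n,
    D.plantedWalks x t (m + 1) v ≤ pathWalks x t (m + 1) v +
      (D.growth * (1 + η)) ^ m * (D.d t + δ * (1 - 2⁻¹ ^ m)) / D.S *
        (D.d v + δ * if v ∈ Finset.univ.image x then 1 else 0) := by
  have hS := D.S_nonneg
  have hdm := D.dmax_nonneg
  have hpm := D.pmax_nonneg
  have hdt := D.nonneg t
  have hsum := D.sum_sq_div
  set g := D.growth
  have hδ0 : 0 ≤ δ := by rw [hδ]; positivity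
  have hη0 : 0 ≤ η := by rw [hη]; positivity
  have hδg : g * δ = 4 * D.dmax := by rw [hδ]; field_simp
  have hηg : g * η = δ * ((r + 1 : ℕ) * (D.dmax / D.S)) := by
    rw [hη, hδ, pmax]; field_simp
  set ι : Fin n → ℝ := fun v => if v ∈ Finset.univ.image x then 1 else 0 with hι
  have hι0 : ∀ v, 0 ≤ ι v := fun v => by simp only [hι]; split_ifs <;> norm_num
  have hι1 : ∀ v, ι v ≤ 1 := fun v => by simp only [hι]; split_ifs <;> norm_num
  set ψ : Fin n → ℝ := fun v => D.d v + δ * ι v with hψ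
  have hψd : ∀ v, D.d v ≤ ψ v := fun v => le_add_of_nonneg_right (mul_nonneg hδ0 (hι0 v))
  -- `ψ` is superharmonic for the sum of both operators, with eigenvalue `g * (1 + η)`
  have hPψ : ∀ v, ∑ w, D.d v * D.d w / D.S * ψ w ≤ D.d v * (g * (1 + η)) := fun v => by
    have h1 : ∑ w, D.d w * ι w ≤ (r + 1 : ℕ) * D.dmax := by
      simp only [hι, mul_ite, mul_one, mul_zero, Finset.sum_ite_mem, Finset.univ_inter]
      refine (Finset.sum_le_card_nsmul _ _ _ fun w _ => D.d_le_dmax w).trans ?_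
      rw [Finset.card_image_of_injective _ hx, Finset.card_univ, Fintype.card_fin, nsmul_eq_mul]
    calc ∑ w, D.d v * D.d w / D.S * ψ w
        = D.d v * ∑ w, D.d w ^ 2 / D.S + D.d v * (δ / D.S) * ∑ w, D.d w * ι w := by
          rw [Finset.mul_sum, Finset.mul_sum, ← Finset.sum_add_distrib]
          exact Finset.sum_congr rfl fun w _ => by simp only [hψ]; ring
      _ ≤ D.d v * g + D.d v * (δ / D.S) * ((r + 1 : ℕ) * D.dmax) := by
          rw [hsum]
          have := D.nonneg v
          gcongr
      _ = D.d v * g + D.d v * (g * η) := by rw [hηg]; ring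
      _ = _ := by ring
  have hAψ : ∀ v, pathStep x ψ v ≤ g * δ * ι v := fun v => by
    refine (pathStep_le hx (B := D.dmax + δ) (by positivity) (fun w => ?_) v).trans ?_
    · exact add_le_add (D.d_le_dmax w) (mul_le_of_le_one_right hδ0 (hι1 w))
    · refine mul_le_mul_of_nonneg_right ?_ (hι0 v)
      have : 4 * δ ≤ g * δ := mul_le_mul_of_nonneg_right hg hδ0
      linarith
  have hMψ : ∀ v, ∑ w, D.d v * D.d w / D.S * ψ w + pathStep x ψ v ≤ g * (1 + η) * ψ v :=
    fun v => by
    have h1 : g * δ * ι v ≤ g * (1 + η) * (δ * ι v) := by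
      have : 0 ≤ g * η * (δ * ι v) := by
        have := hι0 v
        positivity
      linarith
    have h2 := hPψ v
    have h3 := hAψ v
    simp only [hψ] at *
    linarith
  induction m with
  | zero =>
    intro v
    have h1 : D.plantedWalks x t 1 v = D.d v * D.d t / D.S + pathWalks x t 1 v := by
      simp [plantedWalks, pathWalks]
    have h2 : D.d t / D.S * D.d v ≤ D.d t / D.S * ψ v :=
      mul_le_mul_of_nonneg_left (hψd v) (by positivity)
    rw [zero_add, h1, pow_zero, pow_zero, sub_self, mul_zero, add_zero, one_mul]
    calc _ = pathWalks x t 1 v + D.d t / D.S * D.d v := by ring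
      _ ≤ _ := by linarith
  | succ m ih =>
    intro v
    set c := (g * (1 + η)) ^ m * (D.d t + δ * (1 - 2⁻¹ ^ m)) / D.S with hc
    have hc0 : 0 ≤ c := by
      have : (2⁻¹ : ℝ) ^ m ≤ 1 := pow_le_one₀ (by norm_num) (by norm_num)
      have : 0 ≤ 1 - (2⁻¹ : ℝ) ^ m := by linarith
      positivity
    have hτ : ∑ w, D.d v * D.d w / D.S * pathWalks x t (m + 1) w ≤
        (g * (1 + η)) ^ (m + 1) * (δ * 2⁻¹ ^ (m + 1)) / D.S * ψ v := by
      have h4 : D.dmax * 2 ^ (m + 1) ≤ (g * (1 + η)) ^ (m + 1) * (δ * 2⁻¹ ^ (m + 1)) := by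
        calc D.dmax * 2 ^ (m + 1) = (4 * D.dmax) * 4 ^ m * 2⁻¹ ^ (m + 1) := by
              rw [show (4 : ℝ) = 2 ^ 2 by norm_num, ← pow_mul, inv_pow]
              field_simp
              ring
          _ ≤ (g * δ) * g ^ m * 2⁻¹ ^ (m + 1) := by
              rw [hδg]
              gcongr
          _ = g ^ (m + 1) * (δ * 2⁻¹ ^ (m + 1)) := by ring
          _ ≤ _ := by
              gcongr
              nlinarith
      calc ∑ w, D.d v * D.d w / D.S * pathWalks x t (m + 1) w
          ≤ ∑ w, D.d v * D.dmax / D.S * pathWalks x t (m + 1) w := by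
            refine Finset.sum_le_sum fun w _ => mul_le_mul_of_nonneg_right ?_
              (pathWalks_nonneg t _ w)
            have := D.nonneg v
            have := D.d_le_dmax w
            gcongr
        _ = D.d v * D.dmax / D.S * ∑ w, pathWalks x t (m + 1) w := by rw [Finset.mul_sum]
        _ ≤ D.d v * D.dmax / D.S * 2 ^ (m + 1) := by
            have := D.nonneg v
            gcongr
            exact sum_pathWalks_le hx t _
        _ = D.dmax * 2 ^ (m + 1) / D.S * D.d v := by ring
        _ ≤ _ := by
            have := D.nonneg v
            gcongr
            exact hψd v
    have hmono : D.plantedWalks x t (m + 1 + 1) v ≤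
        ∑ w, D.d v * D.d w / D.S * (pathWalks x t (m + 1) w + c * ψ w) +
          pathStep x (fun w => pathWalks x t (m + 1) w + c * ψ w) v :=
      add_le_add (Finset.sum_le_sum fun w _ =>
        mul_le_mul_of_nonneg_left (ih w) (D.mul_div_mem v w).1) (pathStep_mono ih v)
    refine hmono.trans ?_
    rw [pathStep_add_mul]
    have hsplit : ∑ w, D.d v * D.d w / D.S * (pathWalks x t (m + 1) w + c * ψ w) =
        ∑ w, D.d v * D.d w / D.S * pathWalks x t (m + 1) w +
          c * ∑ w, D.d v * D.d w / D.S * ψ w := by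
      rw [Finset.mul_sum, ← Finset.sum_add_distrib]
      exact Finset.sum_congr rfl fun w _ => by ring
    rw [hsplit]
    have h5 := mul_le_mul_of_nonneg_left (hMψ v) hc0
    have h6 : pathWalks x t (m + 1 + 1) v = pathStep x (pathWalks x t (m + 1)) v := rfl
    have h7 : (g * (1 + η)) ^ (m + 1) * (D.d t + δ * (1 - 2⁻¹ ^ (m + 1))) / D.S * ψ v =
        (g * (1 + η)) ^ (m + 1) * (δ * 2⁻¹ ^ (m + 1)) / D.S * ψ v + c * (g * (1 + η) * ψ v) := by
      rw [hc]; ring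
    rw [h6, h7]
    linarith

/-- Upper bound for the second moment of the number of simple paths, by conditioning on the first
of the two paths. -/
theorem integral_SP_sq_le {s t : Fin n} (m : ℕ) (hg : 4 ≤ D.growth) {δ η : ℝ}
    (hδ : δ = 4 * D.dmax / D.growth)
    (hη : η = 4 * (m + 2 : ℕ) * D.pmax / D.growth ^ 2) :
    ∫ G, (SP G (m + 1) s t : ℝ) ^ 2 ∂D.law ≤ (∫ G, (SP G (m + 1) s t : ℝ) ∂D.law) *
      (1 + (D.growth * (1 + η)) ^ m * (D.d t + δ) / D.S * (D.d s + δ)) := by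
  classical
  have hS := D.S_nonneg
  have hdm := D.dmax_nonneg
  have hpm := D.pmax_nonneg
  have hdt := D.nonneg t
  have hds := D.nonneg s
  have hδ0 : 0 ≤ δ := by rw [hδ]; positivity
  have hη0 : 0 ≤ η := by rw [hη]; positivity
  have h1 : ∫ G, (SP G (m + 1) s t : ℝ) ∂D.law =
      ∑ x ∈ simpleSeqs (m + 1) s t, D.prodProb (pathEdges x) := by
    simp only [natCast_SP_eq_sum_present]
    rw [integral_finsetSum _ fun x _ => D.integrable_law _]
    simp only [integral_present]
  have h2 : ∀ G : Sym2 (Fin n) → Bool, (SP G (m + 1) s t : ℝ) ^ 2 =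
      ∑ x ∈ simpleSeqs (m + 1) s t, present (pathEdges x) G * spCount G t (m + 1) {s} s :=
    fun G => by
    rw [← Finset.sum_mul, ← natCast_SP_eq_sum_present, ← natCast_SP, sq]
  rw [h1, integral_congr_ae (ae_of_all _ h2), integral_finsetSum _ fun x _ => D.integrable_law _,
    Finset.sum_mul]
  refine Finset.sum_le_sum fun x hx => ?_
  simp only [simpleSeqs, Finset.mem_filter, Finset.mem_univ, true_and] at hx
  obtain ⟨hxs, hxt, hinj⟩ := hx
  refine (D.integral_present_mul_spCount_le x t (m + 1) _ _ s (Finset.mem_singleton_self s)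
    fun a b h => .inl h).trans (mul_le_mul_of_nonneg_left ?_ (D.prodProb_nonneg _))
  refine (D.plantedWalks_le hinj t hg hδ hη m s).trans (add_le_add ?_ ?_)
  · have := (pathWalks_last hinj (m + 1) 0).2 (by simp)
    rwa [hxs, hxt] at this
  · have h3 : (0 : ℝ) < 2⁻¹ ^ m := by positivity
    have h4 : (2⁻¹ : ℝ) ^ m ≤ 1 := pow_le_one₀ (by norm_num) (by norm_num)
    have h5 : 0 ≤ 1 - (2⁻¹ : ℝ) ^ m := by linarith
    gcongr
    · exact mul_le_of_le_one_right hδ0 (by linarith)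
    · split_ifs <;> simp [hδ0]

/-! ### Combination of the moment bounds -/

/-- If a simple path from `s` to `t` exists with positive probability, then `s` and `t` have
positive expected degree. -/
theorem pos_of_integral_SP_pos {s t : Fin n} (m : ℕ)
    (h : 0 < ∫ G, (SP G (m + 1) s t : ℝ) ∂D.law) : 0 < D.d s ∧ 0 < D.d t ∧ 0 < D.S := by
  simp only [natCast_SP_eq_sum_present] at h
  rw [integral_finsetSum _ fun x _ => D.integrable_law _] at h
  simp only [integral_present] at h
  obtain ⟨x, hx, hne⟩ := Finset.exists_ne_zero_of_sum_ne_zero h.ne'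
  simp only [simpleSeqs, Finset.mem_filter, Finset.mem_univ, true_and] at hx
  have hedge : ∀ i : Fin (m + 1), D.d (x i.castSucc) * D.d (x i.succ) / D.S ≠ 0 := fun i => by
    rw [← edgeProb_mk]
    exact Finset.prod_ne_zero_iff.1 hne _ (Finset.mem_image_of_mem _ (Finset.mem_univ i))
  have h0 := hedge 0
  have h1 := hedge (Fin.last m)
  rw [Fin.castSucc_zero, hx.1] at h0
  rw [Fin.succ_last, hx.2.1] at h1
  have hS : D.S ≠ 0 := fun h => by simp [h] at h0
  refine ⟨(D.nonneg s).lt_of_ne' fun h => ?_, (D.nonneg t).lt_of_ne' fun h => ?_,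
    D.S_nonneg.lt_of_ne' hS⟩
  · simp [h] at h0
  · simp [h] at h1

theorem one_add_pow_le_exp {m : ℕ} {R c : ℝ} (hm : m ≤ R) (hc : 0 ≤ c) :
    (1 + c) ^ m ≤ Real.exp (R * c) := by
  calc (1 + c) ^ m ≤ Real.exp c ^ m := by
        gcongr
        rw [add_comm]
        exact Real.add_one_le_exp c
    _ = Real.exp (m * c) := (Real.exp_nat_mul c m).symm
    _ ≤ _ := Real.exp_le_exp.2 (mul_le_mul_of_nonneg_right hm hc)

set_option maxHeartbeats 600000 in
/-- The bounds on the first moment of `NBP` and the second moment of `SP`, relative to the first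
moment of `SP`, in terms of the quantities that are assumed to be small. -/
theorem moment_ratios_le {s t : Fin n} (hst : s ≠ t) (r : ℕ) {x y z E : ℝ}
    (hE : E = ∫ G, (SP G r s t : ℝ) ∂D.law) (hE0 : 0 < E)
    (hx : x = r * (D.S / D.S₂)) (hy : y = r ^ 2 * (D.S / D.S₂) * D.pmax)
    (hz : z = D.dmax * D.S / (D.S₂ * min (D.d s) (D.d t))) (hx4 : 4 * x ≤ 1) (hy8 : 8 * y ≤ 1) :
    (∫ G, (NBP G r s t : ℝ) ∂D.law) / E ≤ Real.exp (8 * y * x + 4 * y) / (1 - 2 * y) ∧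
    (∫ G, (SP G r s t : ℝ) ^ 2 ∂D.law) / E ^ 2 ≤
      1 / E + Real.exp (8 * y) * (1 + 4 * z) ^ 2 / (1 - 2 * y) := by
  cases r with
  | zero =>
    rw [hE] at hE0
    simp [natCast_SP, spCount, hst] at hE0
  | succ m =>
  obtain ⟨hs, ht, hS⟩ := D.pos_of_integral_SP_pos m (hE ▸ hE0)
  have hS₂ : 0 < D.S₂ := (pow_pos hs 2).trans_le
    (Finset.single_le_sum (fun i _ => sq_nonneg (D.d i)) (Finset.mem_univ s))
  have hg : 0 < D.growth := div_pos hS₂ hS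
  have hdm := D.dmax_nonneg
  have hpm := D.pmax_nonneg
  have hr1 : (1 : ℝ) ≤ (m + 1 : ℕ) := by exact_mod_cast Nat.le_add_left 1 m
  have hmr : (m : ℝ) ≤ (m + 1 : ℕ) := by exact_mod_cast Nat.le_succ m
  have hNr : ((m + 2 : ℕ) : ℝ) ≤ 2 * (m + 1 : ℕ) := by push_cast; linarith [m.cast_nonneg (α := ℝ)]
  have hinv : D.S / D.S₂ = 1 / D.growth := by rw [growth, one_div_div]
  have hz' : z = D.dmax / D.growth / min (D.d s) (D.d t) := by
    rw [hz, growth, div_div_eq_mul_div, div_div]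
  have hlow := fun L h0 h => D.le_integral_SP hst m (L := L) h0 h
  have hNB := fun α h1 h2 h3 => D.integral_NBP_le hst m hg h1 h2 (α := α) h3
  have hsq := fun δ η h1 h2 h3 => D.integral_SP_sq_le (s := s) (t := t) m h1 (δ := δ) (η := η) h2 h3
  rw [← hE] at hlow hsq
  generalize hNdef : ((m + 2 : ℕ) : ℝ) = N at *
  generalize ((m + 1 : ℕ) : ℝ) = R at *
  rw [hinv] at hx hy
  generalize D.growth = g at *
  generalize D.pmax = p at *
  generalize D.dmax = M at *
  generalize D.d s = a at *
  generalize D.d t = b at *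
  generalize D.S = S at *
  have hR0 : 0 < R := by linarith
  have hN0 : 0 ≤ N := by
    rw [← hNdef]
    exact Nat.cast_nonneg _
  have hyg : R ^ 2 * p = y * g := by rw [hy]; field_simp
  have hxg : R = x * g := by rw [hx]; field_simp
  have hy0 : 0 ≤ y := by rw [hy]; positivity
  have hx0 : 0 ≤ x := by rw [hx]; positivity
  have hg4R : 4 * R ≤ g := by rw [hxg]; nlinarith
  have hNR : N * R * p ≤ 2 * y * g := by
    calc N * R * p ≤ 2 * R * R * p := by gcongr
      _ = 2 * (R ^ 2 * p) := by ring
      _ = _ := by rw [hyg]; ring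
  have hy1 : 0 < 1 - 2 * y := by linarith
  have hNp : N * p ≤ N * R * p := by
    have : 0 ≤ N * p := by positivity
    nlinarith
  -- all moments are compared with `μ`, the expected number of walks without restrictions
  set μ := a * b / S * g ^ m with hμ
  have hμ0 : 0 < μ := by positivity
  have hEμ : μ * (1 - 2 * y) ≤ E := by
    refine le_trans ?_ (hlow (g - N * p) (by nlinarith) le_rfl)
    have h1 : g - N * p = g * (1 + -(N * p / g)) := by field_simp; ring
    have h2 : N * p / g ≤ 1 := by rw [div_le_one hg]; nlinarith
    have h3 : (m : ℝ) * (N * p / g) ≤ 2 * y := by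
      calc (m : ℝ) * (N * p / g) ≤ R * (N * p / g) := by gcongr
        _ = N * R * p / g := by ring
        _ ≤ 2 * y := by rw [div_le_iff₀ hg]; exact hNR
    have h4 := one_add_mul_le_pow (show -2 ≤ -(N * p / g) by linarith) m
    rw [h1, mul_pow, hμ, mul_assoc (a * b / S)]
    gcongr
    linarith
  constructor
  · have h1 := hNB _ (by linarith) (by
      calc 2 * N ^ 2 * p ≤ 2 * (2 * R) ^ 2 * p := by gcongr
        _ = 8 * (R ^ 2 * p) := by ring
        _ ≤ g := by rw [hyg]; nlinarith) rfl
    have h2 : a * (b / S * (g * (1 + (2 * N ^ 2 * p / g ^ 2 + 2 * N * p / g))) ^ m) ≤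
        μ * Real.exp (8 * y * x + 4 * y) := by
      rw [mul_pow]
      calc _ = μ * (1 + (2 * N ^ 2 * p / g ^ 2 + 2 * N * p / g)) ^ m := by rw [hμ]; ring
        _ ≤ μ * Real.exp (R * (2 * N ^ 2 * p / g ^ 2 + 2 * N * p / g)) := by
          gcongr
          exact one_add_pow_le_exp hmr (by positivity)
        _ ≤ _ := by
          gcongr
          calc R * (2 * N ^ 2 * p / g ^ 2 + 2 * N * p / g)
              ≤ R * (2 * (2 * R) ^ 2 * p / g ^ 2 + 2 * (2 * R) * p / g) := by gcongr
            _ = 8 * y * x + 4 * y := by rw [hx, hy]; field_simp; ring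
    calc _ ≤ μ * Real.exp (8 * y * x + 4 * y) / (μ * (1 - 2 * y)) := by
          gcongr
          exact h1.trans h2
      _ = _ := by field_simp
  · have hab : 0 < min a b := lt_min hs ht
    have hz0 : 0 ≤ z := by rw [hz']; positivity
    have hzM : M / g = z * min a b := by rw [hz']; field_simp
    have h1 := hsq _ _ (by linarith) rfl rfl
    have hz4 : 0 ≤ 4 * z := by positivity
    have hδa : 4 * M / g ≤ 4 * z * a := by
      rw [mul_div_assoc, hzM, ← mul_assoc]
      exact mul_le_mul_of_nonneg_left (min_le_left a b) hz4
    have hδb : 4 * M / g ≤ 4 * z * b := by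
      rw [mul_div_assoc, hzM, ← mul_assoc]
      exact mul_le_mul_of_nonneg_left (min_le_right a b) hz4
    have hexp : R * (4 * N * p / g ^ 2) ≤ 8 * y := by
      calc R * (4 * N * p / g ^ 2) = 4 * (N * R * p) / g ^ 2 := by ring
        _ ≤ 4 * (2 * y * g) / g ^ 2 := by gcongr
        _ = 8 * y / g := by field_simp; ring
        _ ≤ 8 * y := div_le_self (by positivity) (by linarith)
    have h2 : (g * (1 + 4 * N * p / g ^ 2)) ^ m * (b + 4 * M / g) / S * (a + 4 * M / g) ≤
        μ * (Real.exp (8 * y) * (1 + 4 * z) ^ 2) := by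
      calc _ ≤ (g * (1 + 4 * N * p / g ^ 2)) ^ m * (b + 4 * z * b) / S * (a + 4 * z * a) := by
            gcongr
        _ = μ * ((1 + 4 * N * p / g ^ 2) ^ m * (1 + 4 * z) ^ 2) := by rw [mul_pow, hμ]; ring
        _ ≤ _ := by
            gcongr
            exact (one_add_pow_le_exp hmr (by positivity)).trans (Real.exp_le_exp.2 hexp)
    calc _ ≤ E * (1 + μ * (Real.exp (8 * y) * (1 + 4 * z) ^ 2)) / E ^ 2 := by
          gcongr
          exact h1.trans (by gcongr)
      _ = 1 / E + μ * (Real.exp (8 * y) * (1 + 4 * z) ^ 2) / E := by field_simp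
      _ ≤ 1 / E + μ * (Real.exp (8 * y) * (1 + 4 * z) ^ 2) / (μ * (1 - 2 * y)) := by gcongr
      _ = _ := by field_simp

/-- A quantitative form of the first and second moment method. -/
theorem one_sub_le_law {s t : Fin n} (r : ℕ) {δ E : ℝ} (hδ : 0 < δ)
    (hE : E = ∫ G, (SP G r s t : ℝ) ∂D.law) (hE0 : 0 < E) :
    1 - (4 * ((∫ G, (SP G r s t : ℝ) ^ 2 ∂D.law) / E ^ 2 - 1) +
        2 / δ * ((∫ G, (NBP G r s t : ℝ) ∂D.law) / E - 1)) ≤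
      D.law.real {G | 0 < SP G r s t ∧ |(NBP G r s t : ℝ) / (SP G r s t : ℝ) - 1| ≤ δ} := by
  set X : (Sym2 (Fin n) → Bool) → ℝ := fun G => SP G r s t with hX
  set Y : (Sym2 (Fin n) → Bool) → ℝ := fun G => NBP G r s t with hY
  have hXY : ∀ G, X G ≤ Y G := fun G => Nat.cast_le.2 (SP_le_NBP G r s t)
  set good := {G | 0 < SP G r s t ∧ |(NBP G r s t : ℝ) / (SP G r s t : ℝ) - 1| ≤ δ}
  set A := {G | E ^ 2 / 4 ≤ (X G - E) ^ 2} with hA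
  set B := {G | δ * E / 2 ≤ Y G - X G} with hB
  have hcover : Set.univ ⊆ good ∪ (A ∪ B) := fun G _ => by
    by_contra hG
    simp only [Set.mem_union, not_or] at hG
    obtain ⟨h1, h2, h3⟩ := hG
    simp only [hA, hB, Set.mem_ofPred_eq, not_le] at h2 h3
    have hXE : E / 2 < X G := by
      have := abs_lt_of_sq_lt_sq (show (X G - E) ^ 2 < (E / 2) ^ 2 by linarith) (by positivity)
      linarith [(abs_lt.1 this).1]
    have hX0 : 0 < X G := by linarith
    refine h1 ⟨Nat.cast_pos.1 hX0, ?_⟩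
    change |Y G / X G - 1| ≤ δ
    have h4 : Y G / X G - 1 = (Y G - X G) / X G := by field_simp
    rw [h4, abs_of_nonneg (div_nonneg (by linarith [hXY G]) hX0.le), div_le_iff₀ hX0]
    nlinarith
  have hmeas : 1 ≤ D.law.real good + (D.law.real A + D.law.real B) := by
    calc 1 = D.law.real Set.univ := by simp
      _ ≤ D.law.real (good ∪ (A ∪ B)) := measureReal_mono hcover
      _ ≤ _ := (measureReal_union_le _ _).trans
        (add_le_add_right (measureReal_union_le _ _) _)
  have hAle : D.law.real A ≤ 4 * ((∫ G, X G ^ 2 ∂D.law) / E ^ 2 - 1) := by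
    have h1 := mul_meas_ge_le_integral_of_nonneg (μ := D.law) (f := fun G => (X G - E) ^ 2)
      (ae_of_all _ fun G => sq_nonneg _) (D.integrable_law _) (E ^ 2 / 4)
    have h2 : ∫ G, (X G - E) ^ 2 ∂D.law = (∫ G, X G ^ 2 ∂D.law) - E ^ 2 := by
      have h3 : ∀ G, (X G - E) ^ 2 = X G ^ 2 - (2 * E) * X G + E ^ 2 := fun G => by ring
      rw [integral_congr_ae (ae_of_all _ h3), integral_add (D.integrable_law _)
        (D.integrable_law _), integral_sub (D.integrable_law _) (D.integrable_law _),
        integral_const_mul, ← hE]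
      simp
      ring
    rw [h2] at h1
    have h4 : 4 * ((∫ G, X G ^ 2 ∂D.law) / E ^ 2 - 1) =
        ((∫ G, X G ^ 2 ∂D.law) - E ^ 2) / (E ^ 2 / 4) := by field_simp
    rw [h4, le_div_iff₀ (by positivity), mul_comm]
    exact h1
  have hBle : D.law.real B ≤ 2 / δ * ((∫ G, Y G ∂D.law) / E - 1) := by
    have h1 := mul_meas_ge_le_integral_of_nonneg (μ := D.law) (f := fun G => Y G - X G)
      (ae_of_all _ fun G => sub_nonneg.2 (hXY G)) (D.integrable_law _) (δ * E / 2)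
    rw [integral_sub (D.integrable_law _) (D.integrable_law _), ← hE] at h1
    have h4 : 2 / δ * ((∫ G, Y G ∂D.law) / E - 1) = ((∫ G, Y G ∂D.law) - E) / (δ * E / 2) := by
      field_simp
    rw [h4, le_div_iff₀ (by positivity), mul_comm]
    exact h1
  linarith

end ExpectedDegrees

theorem corollary1 (n : ℕ → ℕ) (D : ∀ k, ExpectedDegrees (n k))
    (s t : ∀ k, Fin (n k)) (hst : ∀ k, s k ≠ t k) (r : ℕ → ℕ)
    (h_deg : Tendsto (fun k => (D k).dmax * (D k).S /
      ((D k).S₂ * min ((D k).d (s k)) ((D k).d (t k)))) atTop (𝓝 0))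
    (h_len : Tendsto (fun k => (r k : ℝ) * ((D k).S / (D k).S₂)) atTop (𝓝 0))
    (h_pmax : Tendsto (fun k => (r k : ℝ) ^ 2 * ((D k).S / (D k).S₂) * (D k).pmax)
      atTop (𝓝 0))
    (h_exp : Tendsto (fun k => ∫ G, (SP G (r k) (s k) (t k) : ℝ) ∂(D k).law) atTop atTop) :
    ∃ δ : ℕ → ℝ, Tendsto δ atTop (𝓝 0) ∧
      Tendsto (fun k => (D k).law.real {G | 0 < SP G (r k) (s k) (t k) ∧
        |(NBP G (r k) (s k) (t k) : ℝ) / (SP G (r k) (s k) (t k) : ℝ) - 1| ≤ δ k})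
        atTop (𝓝 1) := by
  set E : ℕ → ℝ := fun k => ∫ G, (SP G (r k) (s k) (t k) : ℝ) ∂(D k).law with hE
  set F : ℕ → ℝ := fun k => ∫ G, (NBP G (r k) (s k) (t k) : ℝ) ∂(D k).law with hF
  set Q : ℕ → ℝ := fun k => ∫ G, (SP G (r k) (s k) (t k) : ℝ) ^ 2 ∂(D k).law with hQ
  have hsmall : ∀ᶠ k in atTop, 0 < E k ∧ 4 * ((r k : ℝ) * ((D k).S / (D k).S₂)) ≤ 1 ∧
      8 * ((r k : ℝ) ^ 2 * ((D k).S / (D k).S₂) * (D k).pmax) ≤ 1 := by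
    filter_upwards [h_exp.eventually_gt_atTop 0,
      h_len.eventually_le_const (show (0 : ℝ) < 1 / 4 by norm_num),
      h_pmax.eventually_le_const (show (0 : ℝ) < 1 / 8 by norm_num)] with k h0 h1 h2
    exact ⟨h0, by linarith, by linarith⟩
  have hbd := hsmall.mono fun k h => (D k).moment_ratios_le (hst k) (r k) (E := E k) rfl h.1
    rfl rfl rfl h.2.1 h.2.2
  have hden : Tendsto (fun k => 1 - 2 * ((r k : ℝ) ^ 2 * ((D k).S / (D k).S₂) * (D k).pmax))
      atTop (𝓝 1) := by simpa using (h_pmax.const_mul 2).const_sub 1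
  have hFE : ∀ᶠ k in atTop, 0 ≤ F k / E k - 1 := hsmall.mono fun k h => by
    rw [sub_nonneg, le_div_iff₀ h.1, one_mul]
    exact integral_mono ((D k).integrable_law _) ((D k).integrable_law _)
      fun G => Nat.cast_le.2 (SP_le_NBP G _ _ _)
  have hF1 : Tendsto (fun k => F k / E k) atTop (𝓝 1) := by
    refine tendsto_of_tendsto_of_tendsto_of_le_of_le' tendsto_const_nhds ?_
      (hFE.mono fun k h => sub_nonneg.1 h) (hbd.mono fun k h => h.1)
    have h1 := (((h_pmax.const_mul 8).mul h_len).add (h_pmax.const_mul 4))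
    have h2 := ((Real.continuous_exp.tendsto _).comp h1).div hden one_ne_zero
    simpa [Function.comp_def, Pi.div_def] using h2
  obtain ⟨U, hU, hQU⟩ : ∃ U : ℕ → ℝ, Tendsto U atTop (𝓝 1) ∧
      ∀ᶠ k in atTop, Q k / E k ^ 2 ≤ U k := by
    refine ⟨_, ?_, hbd.mono fun k h => h.2⟩
    have h1 := (Real.continuous_exp.tendsto _).comp (h_pmax.const_mul 8)
    have h2 := ((h_deg.const_mul 4).const_add 1).pow 2
    have h3 := (h_exp.inv_tendsto_atTop).add ((h1.mul h2).div hden one_ne_zero)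
    simpa [Function.comp_def, Pi.div_def] using h3
  -- the added `1 / (k + 1)` keeps `δ k` positive when `F k = E k`
  set θ : ℕ → ℝ := fun k => F k / E k - 1 + 1 / ((k : ℝ) + 1) with hθ
  have hθ0 : Tendsto (fun k => √(θ k)) atTop (𝓝 0) := by
    have h1 : Tendsto θ atTop (𝓝 0) := by
      simpa [hθ] using (hF1.sub_const 1).add tendsto_one_div_add_atTop_nhds_zero_nat
    simpa [Function.comp_def] using (Real.continuous_sqrt.tendsto _).comp h1
  refine ⟨fun k => 2 * √(θ k), by simpa using hθ0.const_mul 2, ?_⟩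
  have hlow : Tendsto (fun k => 1 - (4 * (U k - 1) + √(θ k))) atTop (𝓝 1) := by
    simpa using (((hU.sub_const 1).const_mul 4).add hθ0).const_sub 1
  refine tendsto_of_tendsto_of_tendsto_of_le_of_le' hlow tendsto_const_nhds ?_
    (Eventually.of_forall fun k => measureReal_le_one)
  filter_upwards [hsmall, hFE, hQU] with k h0 h1 h2
  have h3 : (0 : ℝ) < 1 / ((k : ℝ) + 1) := by positivity
  have hθk : 0 < θ k := by simp only [hθ]; linarith
  have hsq : 0 < √(θ k) := Real.sqrt_pos.2 hθk
  have h4 := (D k).one_sub_le_law (s := s k) (t := t k) (r k) (δ := 2 * √(θ k)) (E := E k)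
    (by positivity) rfl h0.1
  refine le_trans ?_ h4
  have h5 : 2 / (2 * √(θ k)) * (F k / E k - 1) ≤ √(θ k) := by
    calc 2 / (2 * √(θ k)) * (F k / E k - 1) ≤ 2 / (2 * √(θ k)) * θ k := by
          gcongr
          simp only [hθ]
          linarith
      _ = θ k / √(θ k) := by field_simp
      _ = √(θ k) := Real.div_sqrt
  linarith
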